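/- \textbf{Setting.} A stream is a sequence $((V_1,p_1,\tau_1),\dots,(V_N,p_N,\tau_N))$, where item $i$ covers the set of topics $V_i\subseteq C=\{c_1,\dots,c_d\}$, is clicked with probability $p_i\in[0,1]$ each time it is presented, and $\tau_i\in\{0,1\}$ says whether the user accesses the system at time $i$. Let $r_1<\dots<r_T$ be the times with $\tau_{r_t}=1$, so $T$ is the number of visits. A solution with budget $k\ge 1$ is a tuple $(X_1,\dots,X_T)$ with $X_t\subseteq\{1,\dots,r_t\}$ and $|X_t|\le k$. Its value is the expected number of distinct topics covered by the clicked items, where presentations of the same item at different visits are distinct copies and all clicks are independent: $$f(X_1,\dots,X_T)=\sum_{j=1}^d\Bigl(1-\prod_{t=1}^T\ \prod_{i\in X_t,\ c_j\in V_i}(1-p_i)\Bigr).$$ More generally, $f(A)$ denotes the expected number of distinct topics covered by the clicked elements of a set $A$ of copies $i^{(j)}$ of items, each clicked independently with probability $p_i$; $f(A\mid B)=f(A\cup B)-f(B)$. \textbf{Algorithm Storm} (input $T'\ge1$ and $k$). Start with empty candidate sets $A_1,\dots,A_{T'}$, all active. Write $A=\bigcup_{q=1}^{T'}A_q$ (including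 inactive sets), and for $c\in A$ let $\nu(c)=f(c\mid\{c'\in A: c'\text{ was inserted before }c\})$. When item $i$ arrives, go through the active indices $j$ in increasing order: if $|A_j|<k$, insert the copy $i^{(j)}$ into $A_j$; otherwise let $c'$ minimize $\nu$ over $A_j$, and if $f(i^{(j)}\mid A)\ge 2\nu(c')$, replace $c'$ by $i^{(j)}$ in $A_j$. Then, if $\tau_i=1$ and $G_1,\dots,G_{t-1}$ are the sets presented at the previous visits, choose an active $j^*$ that maximizes $f(A_j\mid G_1\cup\dots\cup G_{t-1})$, present $G_t=A_{j^*}$, and deactivate $j^*$ ($A_{j^*}$ does not change any more). Ties are broken arbitrarily. The algorithm evaluates $f$ only through an oracle. Its time is the number of oracle calls over the whole stream; its response time is the largest number of oracle calls made for any visit to select the presented set, after the item arriving at that time has been processed; its space is the largest number of words in use at any time (per user: identifiers and probabilities of the stored copies, and bookkeeping; the storage of the items themselves is shared and not counted). \textbf{Theorem.} There are absolute constants $c_1,c_2,c_3$ such that for every stream with $N$ items and $T$ visits, every $k\ge1$, every $T'\ge \max(T,1)$ and every tie-breaking, Storm presents one set at every visit, the presented sets $G_1,\dots,G_T$ (as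 sets of items) form a solution with budget $k$, and $$f(G_1,\dots,G_T)\ \ge\ \frac{1}{4(T'-T+1)}\,f(X_1,\dots,X_T)\qquad\text{for every solution }(X_1,\dots,X_T)\text{ with budget }k,$$ that is, Storm is $\frac1{4(T'-T+1)}$-competitive. Moreover it uses space at most $c_1T'k$, time at most $c_2NkT'$, and response time at most $c_3T'$. -/

import Mathlib

namespace S3MOR

/-! ### The problem -/

/-- One element of the stream: the topics covered by the news item, the probability that the user
clicks the item when it is presented, and whether the user accesses the system at this time. -/
structure StreamItem (d : ℕ) where
  topics : Finset (Fin d)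
  prob : ℝ
  access : Bool
  prob_nonneg : 0 ≤ prob
  prob_le_one : prob ≤ 1

/-- A stream of `N` items over `d` topics; item `i` arrives at time `i`. -/
abbrev ItemStream (d N : ℕ) : Type := Fin N → StreamItem d

/-- The expected number of distinct topics covered by the clicked elements of `S`, when each
`x ∈ S` is clicked independently with probability `p x`: the expectation is the sum over all
possible sets `D ⊆ S` of clicked elements. -/
def expectedCoverage {κ : Type} [DecidableEq κ] {d : ℕ} (topics : κ → Finset (Fin d))
    (p : κ → ℝ) (S : Finset κ) : ℝ :=
  ∑ D ∈ S.powerset, ((∏ x ∈ D, p x) * ∏ x ∈ S \ D, (1 - p x)) * ((D.biUnion topics).card : ℝ)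

/-- The access times `r_1 < r_2 < ... < r_T`, in order. -/
def visitTimes {d N : ℕ} (S : ItemStream d N) : List (Fin N) :=
  (List.finRange N).filter fun i => (S i).access

/-- The number `T` of user accesses. -/
def numVisits {d N : ℕ} (S : ItemStream d N) : ℕ := (visitTimes S).length

/-- The sets `X_1, ..., X_T` can be presented: at every visit at most `k` items, all of which have
arrived by the time of that visit (the item arriving at that time included). -/
def Feasible {d N : ℕ} (S : ItemStream d N) (k : ℕ)
    (X : Fin (numVisits S) → Finset (Fin N)) : Prop :=
  ∀ t, (X t).card ≤ k ∧ ∀ i ∈ X t, i ≤ (visitTimes S).get t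

/-- The objective: the expected number of distinct topics covered over all visits. Presentations
of the same item at different visits are distinct copies `(t, i)`, clicked independently. -/
def value {d N : ℕ} (S : ItemStream d N) (X : Fin (numVisits S) → Finset (Fin N)) : ℝ :=
  expectedCoverage (fun c : Fin (numVisits S) × Fin N => (S c.2).topics)
    (fun c => (S c.2).prob)
    (Finset.univ.filter fun c => c.2 ∈ X c.1)

/-! ### Programs with an oracle, counting calls and memory -/

/-- Imperative programs over a memory of type `M`, with access to a real-valued oracle on `Q`. -/
inductive Cmd (M Q : Type) : Type 1 where
  /-- change the memory without consulting the oracle -/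
  | assign (g : M → M) : Cmd M Q
  /-- one oracle call; its answer is written to the memory -/
  | call (q : M → Q) (g : ℝ → M → M) : Cmd M Q
  /-- sequential composition -/
  | seq (a b : Cmd M Q) : Cmd M Q
  /-- conditional -/
  | ite (c : M → Bool) (a b : Cmd M Q) : Cmd M Q
  /-- loop over a list that is read off the memory when the loop starts -/
  | forEach (τ : Type) (l : M → List τ) (body : τ → Cmd M Q) : Cmd M Q

/-- Result of an execution: final memory, number of oracle calls, and the largest size of the
memory at any moment. -/
structure Outcome (M : Type) where
  mem : M
  calls : ℕ
  peak : ℕ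

/-- Run a program with oracle `f`, the size of the memory being measured by `size`. -/
def Cmd.exec {M Q : Type} (f : Q → ℝ) (size : M → ℕ) : Cmd M Q → M → Outcome M
  | .assign g, m => ⟨g m, 0, max (size m) (size (g m))⟩
  | .call q g, m => ⟨g (f (q m)) m, 1, max (size m) (size (g (f (q m)) m))⟩
  | .seq a b, m =>
      let o := Cmd.exec f size a m
      let o' := Cmd.exec f size b o.mem
      ⟨o'.mem, o.calls + o'.calls, max o.peak o'.peak⟩
  | .ite c a b, m => if c m then Cmd.exec f size a m else Cmd.exec f size b m
  | .forEach _ l body, m =>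
      (l m).foldl
        (fun o x =>
          let o' := Cmd.exec f size (body x) o.mem
          ⟨o'.mem, o.calls + o'.calls, max o.peak o'.peak⟩)
        ⟨m, 0, size m⟩

/-! ### The algorithm Storm

`ι` is the type of item identifiers, `T'` the given upper bound on the number of visits. The copy
of item `i` that belongs to the `j`-th candidate set is the pair `(i, j)`. -/

/-- The per-user memory. -/
structure Mem (ι : Type) (T' : ℕ) where
  /-- the union of all candidate sets, in order of insertion (oldest first) -/
  sol : List (ι × Fin T')
  /-- the indices of the active candidate sets -/
  active : List (Fin T')
  /-- the sets presented so far -/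
  shown : List (List (ι × Fin T'))
  /-- the output buffer -/
  out : List (ι × Fin T')
  /-- running minimum in the search for the element to be replaced -/
  best : Option ((ι × Fin T') × ℝ)
  /-- running maximum in the search for the candidate set to be presented -/
  bestSet : Option (Fin T' × ℝ)
  /-- two oracle answers -/
  r : ℝ
  s : ℝ

namespace Mem

variable {ι : Type} [DecidableEq ι] {T' : ℕ}

/-- The memory at the start: all candidate sets empty and active. -/
def init : Mem ι T' := ⟨[], List.finRange T', [], [], none, none, 0, 0⟩

/-- The candidate set with index `j`. -/
def cand (m : Mem ι T') (j : Fin T') : List (ι × Fin T') := m.sol.filter fun c => c.2 = j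

/-- The elements of the union of the candidate sets that were inserted before `c`. -/
def before (m : Mem ι T') (c : ι × Fin T') : List (ι × Fin T') := m.sol.takeWhile fun c' => c' ≠ c

/-- The number of words in use. A stored copy is charged three words (item identifier, candidate
set, click probability), every list of presented copies one more. The constant accounts for the
registers, the current stream element, the two nested loop variables with their loop positions, and
the visit counter. (No loop of the program changes the list that it runs over, so that a position in
the stored list suffices.) -/
def words (m : Mem ι T') : ℕ :=
  3 * m.sol.length + m.active.length + 3 * m.shown.flatten.length + m.shown.length
    + 3 * m.out.length + 20

end Mem

/-- How ties are broken: given the memory, the current best element and an equally good new one,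
should the new one be taken? -/
structure TieBreak (ι : Type) (T' : ℕ) where
  forMin : Mem ι T' → ι × Fin T' → ι × Fin T' → Bool
  forMax : Mem ι T' → Fin T' → Fin T' → Bool

section Program

variable {ι : Type} [DecidableEq ι] {T' : ℕ}

/-- Update the running minimum with the element `c` of value `r - s`. -/
noncomputable def updateMin (tie : TieBreak ι T') (c : ι × Fin T') (m : Mem ι T') : Mem ι T' :=
  match m.best with
  | none => { m with best := some (c, m.r - m.s) }
  | some (c₀, v₀) =>
      if m.r - m.s < v₀ ∨ (m.r - m.s = v₀ ∧ tie.forMin m c₀ c = true) then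
        { m with best := some (c, m.r - m.s) }
      else m

/-- Update the running maximum with the candidate set `j` of value `r - s`. -/
noncomputable def updateMax (tie : TieBreak ι T') (j : Fin T') (m : Mem ι T') : Mem ι T' :=
  match m.bestSet with
  | none => { m with bestSet := some (j, m.r - m.s) }
  | some (j₀, v₀) =>
      if v₀ < m.r - m.s ∨ (m.r - m.s = v₀ ∧ tie.forMax m j₀ j = true) then
        { m with bestSet := some (j, m.r - m.s) }
      else m

/-- Replace the element `c'` found by the search for the minimum by the new copy `e`, if the
gain `r - s` of `e` is at least twice the incremental value of `c'`. -/
noncomputable def swap (e : ι × Fin T') (m : Mem ι T') : Mem ι T' :=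
  match m.best with
  | none => m
  | some (c', ν) => if 2 * ν ≤ m.r - m.s then { m with sol := m.sol.erase c' ++ [e] } else m

/-- Present the candidate set found by the search for the maximum and deactivate it. -/
def present (m : Mem ι T') : Mem ι T' :=
  match m.bestSet with
  | none => { m with out := [] }
  | some (j, _) =>
      { m with active := m.active.erase j, shown := m.shown ++ [m.cand j], out := m.cand j }

/-- Write the answer of an oracle call to the first register. -/
def setR (v : ℝ) (m : Mem ι T') : Mem ι T' := { m with r := v }

/-- Write the answer of an oracle call to the second register. -/
def setS (v : ℝ) (m : Mem ι T') : Mem ι T' := { m with s := v }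

/-- Find an element `c` of the candidate set `j` with smallest incremental value
`f (before c + c) - f (before c)`. -/
noncomputable def findMin (tie : TieBreak ι T') (j : Fin T') :
    Cmd (Mem ι T') (Finset (ι × Fin T')) :=
  .seq (.assign fun m => { m with best := none })
    (.forEach (ι × Fin T') (fun m => m.cand j) fun c =>
      .seq (.call (fun m => insert c (m.before c).toFinset) setR)
        (.seq (.call (fun m => (m.before c).toFinset) setS)
          (.assign (updateMin tie c))))

/-- Processing of an arriving item `x`: for every active candidate set, insert the copy of `x` if
there is room, and otherwise swap it in if it is good enough. -/
noncomputable def itemPhase (k : ℕ) (tie : TieBreak ι T') (x : ι) :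
    Cmd (Mem ι T') (Finset (ι × Fin T')) :=
  .forEach (Fin T') (fun m => m.active) fun j =>
    .ite (fun m => decide ((m.cand j).length < k))
      (.assign fun m => { m with sol := m.sol ++ [(x, j)] })
      (.seq (findMin tie j)
        (.seq (.call (fun m => insert (x, j) m.sol.toFinset) setR)
          (.seq (.call (fun m => m.sol.toFinset) setS)
            (.assign (swap (x, j))))))

/-- Response to a user access: among the active candidate sets, present and deactivate one with
largest gain over everything presented before. -/
noncomputable def visitPhase (tie : TieBreak ι T') : Cmd (Mem ι T') (Finset (ι × Fin T')) :=
  .seq (.assign fun m => { m with bestSet := none })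
    (.seq
      (.forEach (Fin T') (fun m => m.active) fun j =>
        .seq (.call (fun m => (m.cand j).toFinset ∪ m.shown.flatten.toFinset) setR)
          (.seq (.call (fun m => m.shown.flatten.toFinset) setS)
            (.assign (updateMax tie j))))
      (.assign present))

/-- What is recorded about a run on (a prefix of) the stream. -/
structure Trace (ι : Type) (T' : ℕ) where
  mem : Mem ι T'
  /-- oracle calls so far -/
  calls : ℕ
  /-- largest number of words in use so far -/
  peak : ℕ
  /-- the outputs, one per visit, in order -/
  outputs : List (List (ι × Fin T'))
  /-- for every visit, the oracle calls between the request and the output -/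
  responseCalls : List ℕ

/-- One step of the stream: the item `x` arrives, and the user accesses the system or not. -/
noncomputable def step (f : Finset (ι × Fin T') → ℝ) (k : ℕ) (tie : TieBreak ι T')
    (tr : Trace ι T') (x : ι × Bool) : Trace ι T' :=
  let a := (itemPhase k tie x.1).exec f Mem.words tr.mem
  if x.2 then
    let b := (visitPhase tie).exec f Mem.words a.mem
    { mem := b.mem
      calls := tr.calls + a.calls + b.calls
      peak := max tr.peak (max a.peak b.peak)
      outputs := tr.outputs ++ [b.mem.out]
      responseCalls := tr.responseCalls ++ [b.calls] }
  else
    { mem := a.mem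
      calls := tr.calls + a.calls
      peak := max tr.peak a.peak
      outputs := tr.outputs
      responseCalls := tr.responseCalls }

/-- Storm on a stream of item identifiers with access bits; the items themselves are seen only
through the oracle `f`. -/
noncomputable def storm (f : Finset (ι × Fin T') → ℝ) (k : ℕ) (tie : TieBreak ι T')
    (l : List (ι × Bool)) : Trace ι T' :=
  l.foldl (step f k tie) ⟨Mem.init, 0, Mem.words (Mem.init : Mem ι T'), [], []⟩

end Program

/-- The oracle: the expected coverage of a set of copies of items. -/
def oracle {d N : ℕ} (S : ItemStream d N) (T' : ℕ) (A : Finset (Fin N × Fin T')) : ℝ :=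
  expectedCoverage (fun c : Fin N × Fin T' => (S c.1).topics) (fun c => (S c.1).prob) A

/-- The run of Storm with parameters `T'` and `k` on the stream `S`. -/
noncomputable def stormRun {d N : ℕ} (S : ItemStream d N) (T' k : ℕ) (tie : TieBreak (Fin N) T') :
    Trace (Fin N) T' :=
  storm (oracle S T') k tie ((List.finRange N).map fun i => (i, (S i).access))

/-- The set of items that Storm presents at the visit `t`. -/
noncomputable def stormSolution {d N : ℕ} (S : ItemStream d N) (T' k : ℕ) (tie : TieBreak (Fin N) T')
    (t : Fin (numVisits S)) : Finset (Fin N) :=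
  (((stormRun S T' k tie).outputs.getD t []).map Prod.fst).toFinset

end S3MOR

open S3MOR

/-! Expected coverage is monotone and submodular, and only these properties are used for the ratio.
Let `sol` be the copies now stored, in insertion order, and `U` the copies ever stored. Three facts
carry the argument.

Swapping loses at most half: `f U ≤ 2 * f sol`. Adding a copy of gain `g` over `sol` raises `f U` by
at most `g`. It raises `f sol` by `g` if there is room, and by at least `g - ν ≥ g / 2` if a copy of
incremental value `ν ≤ g / 2` is thrown out.

Rejections stay justified (`Settled`). A rejected copy has gain below `2ν` for every `ν` in its full
candidate set. Later changes never spoil this: incremental values of surviving copies only grow, a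
newcomer is worth at least as much as the copy it replaces, and gains over the growing `U` only
shrink. Now let `O` have at most `k` settled copies per candidate set. Charging each rejected copy
to a stored one of the same set gives `f O ≤ f U + 2 * f sol ≤ 4 * f sol` (`Core.le_four_mul`),
since incremental values telescope to `f sol`.

A competing solution is compared by giving the items of its visit `t` the label of the candidate set
that Storm presents at visit `t`. That set was active until then, so every item available to the
competitor was offered to it, and all these copies are settled. Finally, at the last visit the
stored copies split into the presented ones and the sets still active, `T' - T` in number. By the
greedy choice each of the latter adds at most the value of the presented union, so `f sol` is at
most `T' - T + 1` times that value (`le_card_succ_mul_of_forall_gain_le`). The greedy choices at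
earlier visits are not needed. -/

namespace S3MOR

/-! ### The objective as a monotone submodular function -/

/-- Monotone submodular set functions that vanish on the empty set. -/
structure MonoSubmodular {α : Type} [DecidableEq α] (f : Finset α → ℝ) : Prop where
  map_empty : f ∅ = 0
  mono : Monotone f
  gain_anti : ∀ {A B : Finset α} (e : α), A ⊆ B → f (insert e B) - f B ≤ f (insert e A) - f A

section Coverage

variable {κ : Type} [DecidableEq κ] {d : ℕ}

/-- The probability that the topic `j` is missed factors over the elements that cover it. -/
theorem expectedCoverage_eq_sum (topics : κ → Finset (Fin d)) (p : κ → ℝ) (S : Finset κ) :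
    expectedCoverage topics p S
      = ∑ j, (1 - ∏ x ∈ S, if j ∈ topics x then 1 - p x else 1) := by
  have hcard : ∀ D : Finset κ, ((D.biUnion topics).card : ℝ)
      = ∑ j : Fin d, (1 - ∏ x ∈ D, if j ∈ topics x then (0 : ℝ) else 1) := by
    intro D
    have hterm : ∀ j : Fin d, (1 - ∏ x ∈ D, if j ∈ topics x then (0 : ℝ) else 1)
        = if j ∈ D.biUnion topics then 1 else 0 := by
      intro j
      split_ifs with hj
      · obtain ⟨x, hx, hjx⟩ := Finset.mem_biUnion.1 hj
        rw [Finset.prod_eq_zero (i := x) hx (by simp [hjx]), sub_zero]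
      · have hj' : ∀ x ∈ D, j ∉ topics x := fun x hx h => hj (Finset.mem_biUnion.2 ⟨x, hx, h⟩)
        rw [Finset.prod_congr rfl fun x hx => if_neg (hj' x hx)]
        simp
    rw [Finset.sum_congr rfl fun j _ => hterm j, Finset.sum_boole, Finset.filter_univ_mem]
  unfold expectedCoverage
  simp_rw [hcard, Finset.mul_sum]
  rw [Finset.sum_comm]
  refine Finset.sum_congr rfl fun j _ => ?_
  -- Both identities expand a product of sums over the elements, clicked plus not clicked. In `h2`
  -- the clicked term of an element covering `j` is zero, which leaves the probability of missing
  -- `j`.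
  have h1 : (1 : ℝ) = ∑ D ∈ S.powerset, (∏ x ∈ D, p x) * ∏ x ∈ S \ D, (1 - p x) := by
    rw [← Finset.prod_add]; simp
  have h2 : (∏ x ∈ S, if j ∈ topics x then 1 - p x else 1)
      = ∑ D ∈ S.powerset, (∏ x ∈ D, p x * if j ∈ topics x then (0 : ℝ) else 1)
        * ∏ x ∈ S \ D, (1 - p x) := by
    rw [← Finset.prod_add]
    refine Finset.prod_congr rfl fun x _ => ?_
    split_ifs <;> ring
  rw [h2]
  conv_rhs => enter [1]; rw [h1]
  rw [← Finset.sum_sub_distrib]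
  refine Finset.sum_congr rfl fun D _ => ?_
  rw [Finset.prod_mul_distrib]
  ring

theorem expectedCoverage_image {κ' : Type} [DecidableEq κ'] (topics : κ' → Finset (Fin d))
    (p : κ' → ℝ) (φ : κ → κ') (hφ : Function.Injective φ) (S : Finset κ) :
    expectedCoverage topics p (S.image φ)
      = expectedCoverage (fun x => topics (φ x)) (fun x => p (φ x)) S := by
  simp_rw [expectedCoverage_eq_sum, Finset.prod_image hφ.injOn]

/-- Per topic, the gain of `e` is the probability that the present elements miss the topic, times
the probability that `e` hits it. The first factor shrinks as the set grows. -/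
theorem monoSubmodular_expectedCoverage (topics : κ → Finset (Fin d)) (p : κ → ℝ)
    (h0 : ∀ x, 0 ≤ p x) (h1 : ∀ x, p x ≤ 1) : MonoSubmodular (expectedCoverage topics p) := by
  have q0 : ∀ j x, 0 ≤ (if j ∈ topics x then 1 - p x else 1) := fun j x => by
    split_ifs
    · linarith [h1 x]
    · exact zero_le_one
  have q1 : ∀ j x, (if j ∈ topics x then 1 - p x else 1) ≤ 1 := fun j x => by
    split_ifs
    · linarith [h0 x]
    · exact le_rfl
  have anti : ∀ (j : Fin d) {A B : Finset κ}, A ⊆ B →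
      (∏ x ∈ B, if j ∈ topics x then 1 - p x else 1)
        ≤ ∏ x ∈ A, if j ∈ topics x then 1 - p x else 1 := by
    intro j A B hAB
    rw [← Finset.prod_sdiff hAB]
    exact mul_le_of_le_one_left (Finset.prod_nonneg fun x _ => q0 j x)
      (Finset.prod_le_one (fun x _ => q0 j x) fun x _ => q1 j x)
  have mono : Monotone (expectedCoverage topics p) := by
    intro A B hAB
    simp_rw [expectedCoverage_eq_sum]
    exact Finset.sum_le_sum fun j _ => sub_le_sub_left (anti j hAB) 1
  refine ⟨by simp [expectedCoverage], mono, ?_⟩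
  intro A B e hAB
  by_cases he : e ∈ B
  · rw [Finset.insert_eq_of_mem he, sub_self]
    exact sub_nonneg.2 (mono (Finset.subset_insert _ _))
  · have he' : e ∉ A := fun h => he (hAB h)
    simp_rw [expectedCoverage_eq_sum, ← Finset.sum_sub_distrib, Finset.prod_insert he,
      Finset.prod_insert he']
    refine Finset.sum_le_sum fun j _ => ?_
    have := mul_le_mul_of_nonneg_right (anti j hAB) (sub_nonneg.2 (q1 j e))
    linarith

theorem monoSubmodular_oracle {N : ℕ} (S : ItemStream d N) (T' : ℕ) :
    MonoSubmodular (oracle S T') :=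
  monoSubmodular_expectedCoverage _ _ (fun c => (S c.1).prob_nonneg) fun c => (S c.1).prob_le_one

end Coverage

/-! ### Submodularity for adding several elements or sets -/

namespace MonoSubmodular

variable {α : Type} [DecidableEq α] {f : Finset α → ℝ}

theorem nonneg (hf : MonoSubmodular f) (A : Finset α) : 0 ≤ f A :=
  hf.map_empty ▸ hf.mono (Finset.empty_subset A)

theorem gain_nonneg (hf : MonoSubmodular f) (e : α) (A : Finset α) : 0 ≤ f (insert e A) - f A :=
  sub_nonneg.2 (hf.mono (Finset.subset_insert _ _))

theorem union_gain_anti (hf : MonoSubmodular f) (C : Finset α) {A B : Finset α} (h : A ⊆ B) :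
    f (C ∪ B) - f B ≤ f (C ∪ A) - f A := by
  induction C using Finset.induction_on with
  | empty => simp
  | insert e C _ ih =>
    rw [Finset.insert_union, Finset.insert_union]
    have := hf.gain_anti e (Finset.union_subset_union_right h : C ∪ A ⊆ C ∪ B)
    linarith

theorem union_le_add_sum (hf : MonoSubmodular f) (O A : Finset α) :
    f (O ∪ A) ≤ f A + ∑ o ∈ O, (f (insert o A) - f A) := by
  induction O using Finset.induction_on with
  | empty => simp
  | insert e C he ih =>
    rw [Finset.insert_union, Finset.sum_insert he]
    have := hf.gain_anti e (Finset.subset_union_right : A ⊆ C ∪ A)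
    linarith

theorem biUnion_le_add_sum {β : Type} [DecidableEq β] (hf : MonoSubmodular f) (J : Finset β)
    (C : β → Finset α) (A : Finset α) :
    f (J.biUnion C ∪ A) ≤ f A + ∑ j ∈ J, (f (C j ∪ A) - f A) := by
  induction J using Finset.induction_on with
  | empty => simp
  | insert j J hj ih =>
    rw [Finset.biUnion_insert, Finset.sum_insert hj, Finset.union_assoc]
    have := hf.union_gain_anti (C j) (Finset.subset_union_right : A ⊆ J.biUnion C ∪ A)
    linarith

end MonoSubmodular

/-- If every `a` is at most every `b ≥ 0` and there are at least as many `b`s, their sum is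
larger. -/
theorem sum_le_sum_of_forall_le_of_card_le {α β : Type} (s : Finset α) (t : Finset β)
    (a : α → ℝ) (b : β → ℝ) (h : ∀ x ∈ s, ∀ y ∈ t, a x ≤ b y) (hb : ∀ y ∈ t, 0 ≤ b y)
    (hc : s.card ≤ t.card) : ∑ x ∈ s, a x ≤ ∑ y ∈ t, b y := by
  rcases t.eq_empty_or_nonempty with rfl | ht
  · have : s = ∅ := by simpa using hc
    simp [this]
  · obtain ⟨y, hy, hmin⟩ := t.exists_min_image b ht
    calc ∑ x ∈ s, a x ≤ s.card • b y := Finset.sum_le_card_nsmul _ _ _ fun x hx => h x hx y hy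
      _ ≤ t.card • b y := nsmul_le_nsmul_left (hb y hy) hc
      _ ≤ ∑ y ∈ t, b y := Finset.card_nsmul_le_sum _ _ _ hmin

end S3MOR

namespace S3MOR

/-! ### Exchange steps on the stored copies -/

section Exchange

variable {ι : Type} {T' : ℕ}

/-- The copies of the list `sol` that belong to the candidate set `j`. -/
def part (sol : List (ι × Fin T')) (j : Fin T') : List (ι × Fin T') :=
  sol.filter fun c => c.2 = j

theorem mem_part {sol : List (ι × Fin T')} {j : Fin T'} {c : ι × Fin T'} :
    c ∈ part sol j ↔ c ∈ sol ∧ c.2 = j := by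
  simp [part]

theorem part_append_singleton_self (sol : List (ι × Fin T')) (x : ι) (j : Fin T') :
    part (sol ++ [(x, j)]) j = part sol j ++ [(x, j)] := by
  simp [part]

theorem part_append_singleton_of_ne (sol : List (ι × Fin T')) (x : ι) {j j' : Fin T'}
    (h : j' ≠ j) : part (sol ++ [(x, j)]) j' = part sol j' := by
  simp [part, h.symm]

/-! ### Insertion order and incremental values -/

variable [DecidableEq ι]

/-- The copies that precede `c` in `sol`. -/
def earlier (sol : List (ι × Fin T')) (c : ι × Fin T') : List (ι × Fin T') :=
  sol.takeWhile fun c' => c' ≠ c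

/-- The incremental value of `c` in the insertion order `sol`. -/
def incr (f : Finset (ι × Fin T') → ℝ) (sol : List (ι × Fin T')) (c : ι × Fin T') : ℝ :=
  f (insert c (earlier sol c).toFinset) - f (earlier sol c).toFinset

theorem earlier_append_cons {a b : List (ι × Fin T')} {c : ι × Fin T'} (h : c ∉ a) :
    earlier (a ++ c :: b) c = a := by
  unfold earlier
  rw [List.takeWhile_append_of_pos]
  · simp
  · intro x hx
    simp only [ne_eq, decide_not, Bool.not_eq_eq_eq_not, Bool.not_true, decide_eq_false_iff_not]
    rintro rfl
    exact h hx

theorem earlier_append_of_mem {sol : List (ι × Fin T')} {c : ι × Fin T'} (hnd : sol.Nodup)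
    (hc : c ∈ sol) (l : List (ι × Fin T')) : earlier (sol ++ l) c = earlier sol c := by
  obtain ⟨a, b, rfl⟩ := List.append_of_mem hc
  have : c ∉ a := fun h => (List.disjoint_of_nodup_append hnd) h List.mem_cons_self
  rw [List.append_assoc, List.cons_append, earlier_append_cons this, earlier_append_cons this]

theorem earlier_append_singleton {sol : List (ι × Fin T')} {e : ι × Fin T'} (he : e ∉ sol) :
    earlier (sol ++ [e]) e = sol :=
  earlier_append_cons he

theorem incr_append_of_mem (f : Finset (ι × Fin T') → ℝ) {sol : List (ι × Fin T')}
    {c : ι × Fin T'} (hnd : sol.Nodup) (hc : c ∈ sol) (l : List (ι × Fin T')) :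
    incr f (sol ++ l) c = incr f sol c := by
  rw [incr, earlier_append_of_mem hnd hc, incr]

theorem incr_append_singleton (f : Finset (ι × Fin T') → ℝ) {sol : List (ι × Fin T')}
    {e : ι × Fin T'} (he : e ∉ sol) :
    incr f (sol ++ [e]) e = f (insert e sol.toFinset) - f sol.toFinset := by
  rw [incr, earlier_append_singleton he]

theorem earlier_subset (sol : List (ι × Fin T')) (c : ι × Fin T') : earlier sol c ⊆ sol :=
  (List.takeWhile_sublist _).subset

theorem notMem_earlier (sol : List (ι × Fin T')) (c : ι × Fin T') : c ∉ earlier sol c := by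
  intro h
  have := List.mem_takeWhile_imp h
  simp at this

theorem earlier_erase_subset {sol : List (ι × Fin T')} {c c' : ι × Fin T'} (hnd : sol.Nodup)
    (hc : c ∈ sol) (hne : c ≠ c') : earlier (sol.erase c') c ⊆ earlier sol c := by
  obtain ⟨a, b, rfl⟩ := List.append_of_mem hc
  have h : c ∉ a := fun h => (List.disjoint_of_nodup_append hnd) h List.mem_cons_self
  rw [earlier_append_cons h]
  by_cases h' : c' ∈ a
  · rw [List.erase_append_left _ h', earlier_append_cons fun h'' => h (List.mem_of_mem_erase h'')]
    exact List.erase_subset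
  · rw [List.erase_append_right _ h', List.erase_cons_tail (by simpa using hne),
      earlier_append_cons h]
    exact fun x hx => hx

variable {f : Finset (ι × Fin T') → ℝ}

theorem incr_nonneg (hf : MonoSubmodular f) (sol : List (ι × Fin T')) (c : ι × Fin T') :
    0 ≤ incr f sol c :=
  hf.gain_nonneg _ _

/-- Deleting another copy can only shrink the prefix before `c`, so by submodularity incremental
values never fall. This keeps old rejections valid. -/
theorem incr_le_incr_erase (hf : MonoSubmodular f) {sol : List (ι × Fin T')} {c c' : ι × Fin T'}
    (hnd : sol.Nodup) (hc : c ∈ sol) (hne : c ≠ c') :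
    incr f sol c ≤ incr f (sol.erase c') c :=
  hf.gain_anti _ fun x hx => by
    simpa using earlier_erase_subset hnd hc hne (by simpa using hx)

/-- The incremental values telescope. -/
theorem sum_incr (hf : MonoSubmodular f) {sol : List (ι × Fin T')} (hnd : sol.Nodup) :
    ∑ c ∈ sol.toFinset, incr f sol c = f sol.toFinset := by
  induction sol using List.reverseRecOn with
  | nil => simp [hf.map_empty]
  | append_singleton l e ih =>
    have he : e ∉ l := fun h => (List.disjoint_of_nodup_append hnd) h List.mem_cons_self
    have hl : l.Nodup := hnd.of_append_left
    have hset : (l ++ [e]).toFinset = insert e l.toFinset := by ext; simp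
    rw [hset, Finset.sum_insert (by simpa using he), incr_append_singleton f he,
      Finset.sum_congr rfl fun c hc => incr_append_of_mem f hl (by simpa using hc) [e], ih hl]
    ring

/-- Removing `c'` costs at most its incremental value. -/
theorem sub_incr_le_erase (hf : MonoSubmodular f) {sol : List (ι × Fin T')} {c' : ι × Fin T'}
    (hc' : c' ∈ sol) :
    f sol.toFinset - incr f sol c' ≤ f (sol.erase c').toFinset := by
  have hset : sol.toFinset = insert c' (sol.erase c').toFinset := by
    ext x
    by_cases h : x = c' <;> simp [h, hc', List.mem_erase_of_ne]
  have hsub : (earlier sol c').toFinset ⊆ (sol.erase c').toFinset := by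
    intro x hx
    rw [List.mem_toFinset] at hx ⊢
    have : x ≠ c' := fun h => notMem_earlier sol c' (h ▸ hx)
    exact (List.mem_erase_of_ne this).2 (earlier_subset _ _ hx)
  have := hf.gain_anti c' hsub
  rw [← hset] at this
  unfold incr
  linarith

/-! ### Invariants under insertion, swap and rejection -/

variable (f) (k : ℕ)

/-- The stored copies `sol` in relation to the set `U` of all copies that were ever stored. -/
structure Core (sol : List (ι × Fin T')) (U : Finset (ι × Fin T')) : Prop where
  nodup : sol.Nodup
  subset : sol.toFinset ⊆ U
  length_le : ∀ j, (part sol j).length ≤ k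
  le_two_mul : f U ≤ 2 * f sol.toFinset

/-- The copy `p` was stored at some time, or its gain is small compared with the incremental
values in its candidate set. -/
def Settled (sol : List (ι × Fin T')) (U : Finset (ι × Fin T')) (p : ι × Fin T') : Prop :=
  p ∈ U ∨ ((part sol p.2).length = k ∧
    ∀ c ∈ part sol p.2, f (insert p U) - f U ≤ 2 * incr f sol c)

/-- The effect of offering the item `x` to the candidate sets in `J`. -/
structure Offered (x : ι) (J : List (Fin T')) (sol : List (ι × Fin T')) (U : Finset (ι × Fin T'))
    (sol' : List (ι × Fin T')) (U' : Finset (ι × Fin T')) : Prop where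
  core : Core f k sol' U'
  settled : ∀ p, Settled f k sol U p → Settled f k sol' U' p
  settled_new : ∀ j ∈ J, Settled f k sol' U' (x, j)
  part_eq : ∀ j, j ∉ J → part sol' j = part sol j
  mem_imp : ∀ c ∈ U', c ∈ U ∨ (c.1 = x ∧ c.2 ∈ J)

variable {f} {k}

theorem Offered.refl (x : ι) {sol : List (ι × Fin T')} {U : Finset (ι × Fin T')}
    (h : Core f k sol U) : Offered f k x [] sol U sol U :=
  ⟨h, fun _ hp => hp, by simp, fun _ _ => rfl, fun _ hc => .inl hc⟩

theorem Offered.trans {x : ι} {J J' : List (Fin T')} {sol sol' sol'' : List (ι × Fin T')}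
    {U U' U'' : Finset (ι × Fin T')} (h : Offered f k x J sol U sol' U')
    (h' : Offered f k x J' sol' U' sol'' U'') : Offered f k x (J ++ J') sol U sol'' U'' where
  core := h'.core
  settled p hp := h'.settled p (h.settled p hp)
  settled_new j hj := by
    rcases List.mem_append.1 hj with hj | hj
    · exact h'.settled _ (h.settled_new j hj)
    · exact h'.settled_new j hj
  part_eq j hj := by
    rw [List.mem_append, not_or] at hj
    rw [h'.part_eq j hj.2, h.part_eq j hj.1]
  mem_imp c hc := by
    rcases h'.mem_imp c hc with hc | hc
    · rcases h.mem_imp c hc with hc | hc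
      · exact .inl hc
      · exact .inr ⟨hc.1, List.mem_append_left _ hc.2⟩
    · exact .inr ⟨hc.1, List.mem_append_right _ hc.2⟩

theorem part_erase {sol : List (ι × Fin T')} (hnd : sol.Nodup) (c : ι × Fin T') (j : Fin T') :
    part (sol.erase c) j = (part sol j).erase c := by
  rw [part, part, hnd.erase_eq_filter, (hnd.filter _).erase_eq_filter, List.filter_filter,
    List.filter_filter]
  exact List.filter_congr fun x _ => Bool.and_comm _ _

theorem Offered.of_room (hf : MonoSubmodular f) {sol : List (ι × Fin T')}
    {U : Finset (ι × Fin T')} (h : Core f k sol U) {x : ι} {j : Fin T'} (hU : (x, j) ∉ U)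
    (hlt : (part sol j).length < k) :
    Offered f k x [j] sol U (sol ++ [(x, j)]) (insert (x, j) U) := by
  have he : (x, j) ∉ sol := fun hx => hU (h.subset (by simpa using hx))
  have hset : (sol ++ [(x, j)]).toFinset = insert (x, j) sol.toFinset := by
    ext; simp [or_comm]
  refine ⟨⟨?_, ?_, ?_, ?_⟩, ?_, ?_, ?_, ?_⟩
  · exact List.nodup_append'.2 ⟨h.nodup, List.nodup_singleton _, by simpa using he⟩
  · rw [hset]
    exact Finset.insert_subset_insert _ h.subset
  · intro j'
    by_cases hj : j' = j
    · subst hj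
      rw [part_append_singleton_self, List.length_append, List.length_singleton]
      omega
    · rw [part_append_singleton_of_ne _ _ hj]
      exact h.length_le j'
  · rw [hset]
    have h1 := hf.gain_anti (x, j) h.subset
    have h2 := hf.gain_nonneg (x, j) sol.toFinset
    have h3 := h.le_two_mul
    linarith
  · rintro p (hp | ⟨hp, hg⟩)
    · exact .inl (Finset.mem_insert_of_mem hp)
    · have hj : p.2 ≠ j := by
        rintro rfl
        omega
      right
      rw [part_append_singleton_of_ne _ _ hj]
      refine ⟨hp, fun c hc => ?_⟩
      rw [incr_append_of_mem f h.nodup (mem_part.1 hc).1]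
      exact (hf.gain_anti p (Finset.subset_insert _ _)).trans (hg c hc)
  · intro j' hj'
    rw [List.mem_singleton.1 hj']
    exact .inl (Finset.mem_insert_self _ _)
  · intro j' hj'
    exact part_append_singleton_of_ne _ _ (by simpa using hj')
  · intro c hc
    rcases Finset.mem_insert.1 hc with rfl | hc
    · exact .inr ⟨rfl, by simp⟩
    · exact .inl hc

theorem Offered.of_swap (hf : MonoSubmodular f) {sol : List (ι × Fin T')}
    {U : Finset (ι × Fin T')} (h : Core f k sol U) {x : ι} {j : Fin T'} (hU : (x, j) ∉ U)
    {c' : ι × Fin T'} (hc' : c' ∈ part sol j) (hmin : ∀ c ∈ part sol j, incr f sol c' ≤ incr f sol c)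
    (hgain : 2 * incr f sol c' ≤ f (insert (x, j) sol.toFinset) - f sol.toFinset) :
    Offered f k x [j] sol U (sol.erase c' ++ [(x, j)]) (insert (x, j) U) := by
  obtain ⟨hc's, hc'j⟩ := mem_part.1 hc'
  have he : (x, j) ∉ sol := fun hx => hU (h.subset (by simpa using hx))
  have hnd := h.nodup.erase c'
  have he' : (x, j) ∉ sol.erase c' := fun hx => he (List.mem_of_mem_erase hx)
  have hset : (sol.erase c' ++ [(x, j)]).toFinset
      = insert (x, j) (sol.erase c').toFinset := by
    ext; simp [or_comm]
  have hsub : (sol.erase c').toFinset ⊆ sol.toFinset := fun y hy => by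
    simpa using List.mem_of_mem_erase (by simpa using hy)
  have hgain' := hf.gain_anti (x, j) hsub
  have hother : ∀ j', j' ≠ j → part (sol.erase c' ++ [(x, j)]) j' = part sol j' := by
    intro j' hj'
    rw [part_append_singleton_of_ne _ _ hj', part_erase h.nodup, List.erase_of_not_mem]
    exact fun hx => hj' ((mem_part.1 hx).2.symm.trans hc'j)
  have hself : part (sol.erase c' ++ [(x, j)]) j = (part sol j).erase c' ++ [(x, j)] := by
    rw [part_append_singleton_self, part_erase h.nodup]
  have hlen : ∀ j', (part (sol.erase c' ++ [(x, j)]) j').length = (part sol j').length := by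
    intro j'
    by_cases hj : j' = j
    · subst hj
      rw [hself, List.length_append, List.length_singleton, List.length_erase_of_mem hc']
      have := List.length_pos_of_mem hc'
      omega
    · rw [hother j' hj]
  have hincr : ∀ c ∈ sol, c ≠ c' →
      incr f sol c ≤ incr f (sol.erase c' ++ [(x, j)]) c := by
    intro c hc hne
    rw [incr_append_of_mem f hnd ((List.mem_erase_of_ne hne).2 hc)]
    exact incr_le_incr_erase hf h.nodup hc hne
  refine ⟨⟨?_, ?_, ?_, ?_⟩, ?_, ?_, ?_, ?_⟩
  · exact List.nodup_append'.2 ⟨hnd, List.nodup_singleton _, by simpa using he'⟩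
  · rw [hset]
    exact Finset.insert_subset_insert _ (hsub.trans h.subset)
  · intro j'
    rw [hlen]
    exact h.length_le j'
  · rw [hset]
    -- With gain `g` over `sol` and removed value `ν`, `f U` grows by at most `g`, while `2 * f sol`
    -- grows by at least `2 * (g - ν) ≥ g`. This is where the threshold factor 2 is chosen.
    have h1 := hf.gain_anti (x, j) h.subset
    have h2 := sub_incr_le_erase hf hc's
    have h3 := h.le_two_mul
    linarith
  · rintro p (hp | ⟨hp, hg⟩)
    · exact .inl (Finset.mem_insert_of_mem hp)
    · right
      refine ⟨by rw [hlen, hp], fun c hc => ?_⟩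
      refine (hf.gain_anti p (Finset.subset_insert _ _)).trans ?_
      obtain ⟨hcs, hcp⟩ := mem_part.1 hc
      rcases List.mem_append.1 hcs with hcs | hcs
      · have hne : c ≠ c' := fun hx => h.nodup.not_mem_erase (hx ▸ hcs)
        have hcs := List.mem_of_mem_erase hcs
        have h1 := hg c (mem_part.2 ⟨hcs, hcp⟩)
        have h2 := hincr c hcs hne
        linarith
      · rw [List.mem_singleton.1 hcs] at hcp ⊢
        rw [incr_append_singleton f he']
        have h1 := hg c' (by rwa [← hcp])
        have h2 := incr_nonneg hf sol c'
        linarith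
  · intro j' hj'
    rw [List.mem_singleton.1 hj']
    exact .inl (Finset.mem_insert_self _ _)
  · intro j' hj'
    exact hother j' (by simpa using hj')
  · intro c hc
    rcases Finset.mem_insert.1 hc with rfl | hc
    · exact .inr ⟨rfl, by simp⟩
    · exact .inl hc

/-- The minimum of the incremental values bounds the gain over `sol`, and the gain over the larger
`U` is smaller still. -/
theorem Offered.of_reject (hf : MonoSubmodular f) {sol : List (ι × Fin T')}
    {U : Finset (ι × Fin T')} (h : Core f k sol U) {x : ι} {j : Fin T'}
    (hlen : k ≤ (part sol j).length) {c' : ι × Fin T'}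
    (hmin : ∀ c ∈ part sol j, incr f sol c' ≤ incr f sol c)
    (hgain : f (insert (x, j) sol.toFinset) - f sol.toFinset < 2 * incr f sol c') :
    Offered f k x [j] sol U sol U := by
  refine ⟨h, fun _ hp => hp, ?_, fun _ _ => rfl, fun _ hc => .inl hc⟩
  intro j' hj'
  rw [List.mem_singleton.1 hj']
  refine .inr ⟨le_antisymm (h.length_le j) hlen, fun c hc => ?_⟩
  have h1 := hf.gain_anti (x, j) h.subset
  have h2 := hmin c hc
  linarith

/-! ### Size bound, the factor 4 and the greedy choice -/

theorem Core.length_sol_le {sol : List (ι × Fin T')} {U : Finset (ι × Fin T')}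
    (h : Core f k sol U) : sol.length ≤ T' * k := by
  have h1 := List.toFinset_card_of_nodup h.nodup
  rw [Finset.card_eq_sum_card_fiberwise (f := Prod.snd) (t := Finset.univ) (by simp)] at h1
  rw [← h1]
  calc _ ≤ ∑ _j : Fin T', k := Finset.sum_le_sum fun j _ => by
        refine le_trans ?_ (h.length_le j)
        rw [part, ← List.toFinset_card_of_nodup (h.nodup.filter _), List.toFinset_filter]
        simp
    _ = T' * k := by simp

/-- A set of settled copies, at most `k` per candidate set, is at most four times as valuable as
the stored copies. -/
theorem Core.le_four_mul (hf : MonoSubmodular f) {sol : List (ι × Fin T')}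
    {U : Finset (ι × Fin T')} (h : Core f k sol U) (O : Finset (ι × Fin T'))
    (hO : ∀ o ∈ O, Settled f k sol U o) (hcard : ∀ j, (O.filter fun c => c.2 = j).card ≤ k) :
    f O ≤ 4 * f sol.toFinset := by
  have h1 : f O ≤ f U + ∑ o ∈ O, (f (insert o U) - f U) :=
    (hf.mono Finset.subset_union_left).trans (hf.union_le_add_sum O U)
  have h2 : ∑ o ∈ O, (f (insert o U) - f U) ≤ ∑ c ∈ sol.toFinset, 2 * incr f sol c := by
    rw [← Finset.sum_fiberwise O Prod.snd, ← Finset.sum_fiberwise sol.toFinset Prod.snd]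
    refine Finset.sum_le_sum fun j _ => ?_
    have hpos : ∀ c ∈ sol.toFinset.filter (fun c => c.2 = j), 0 ≤ 2 * incr f sol c :=
      fun c _ => mul_nonneg zero_le_two (incr_nonneg hf sol c)
    -- Copies already in `U` have zero gain. If some copy in the fibre is outside `U`, its
    -- certificate shows that the candidate set holds exactly `k` copies, enough to charge the whole
    -- fibre.
    by_cases hall : ∀ o ∈ O.filter (fun c => c.2 = j), o ∈ U
    · rw [Finset.sum_eq_zero fun o ho => by
        rw [Finset.insert_eq_of_mem (hall o ho), sub_self]]
      exact Finset.sum_nonneg hpos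
    · push Not at hall
      obtain ⟨o, ho, hoU⟩ := hall
      obtain ⟨hoO, rfl⟩ := Finset.mem_filter.1 ho
      refine sum_le_sum_of_forall_le_of_card_le _ _ _ _ ?_ hpos ?_
      · intro p hp c hc
        obtain ⟨hpO, hpj⟩ := Finset.mem_filter.1 hp
        rcases hO p hpO with hpU | ⟨-, hg⟩
        · rw [Finset.insert_eq_of_mem hpU, sub_self]
          exact hpos c hc
        · refine hg c (mem_part.2 ?_)
          simpa [hpj] using hc
      · refine (hcard _).trans ?_
        rcases hO o hoO with hU | ⟨hlen, -⟩
        · exact absurd hU hoU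
        · rw [← hlen, part, ← List.toFinset_card_of_nodup (h.nodup.filter _), List.toFinset_filter]
          simp
  rw [← Finset.mul_sum, sum_incr hf h.nodup] at h2
  linarith [h.le_two_mul]

/-- The greedy choice: if no active candidate set had a larger gain than the presented one, then
the presented copies are worth a `1 / (#active + 1)` fraction of all stored ones. -/
theorem le_card_succ_mul_of_forall_gain_le (hf : MonoSubmodular f) {sol : List (ι × Fin T')}
    {shown : Finset (ι × Fin T')} {j₀ : Fin T'} {J : Finset (Fin T')}
    (hcover : ∀ c ∈ sol, c ∈ shown ∨ c.2 = j₀ ∨ c.2 ∈ J)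
    (hmax : ∀ j ∈ J, f ((part sol j).toFinset ∪ shown) - f shown
      ≤ f ((part sol j₀).toFinset ∪ shown) - f shown) :
    f sol.toFinset ≤ (J.card + 1) * f ((part sol j₀).toFinset ∪ shown) := by
  set G := (part sol j₀).toFinset ∪ shown with hG
  have h1 : f sol.toFinset ≤ f (J.biUnion (fun j => (part sol j).toFinset) ∪ G) := by
    refine hf.mono fun c hc => ?_
    rw [List.mem_toFinset] at hc
    rcases hcover c hc with h | h | h
    · simp [hG, h]
    · simp [hG, mem_part, h, hc]
    · simp only [Finset.mem_union, Finset.mem_biUnion, List.mem_toFinset, mem_part]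
      exact .inl ⟨c.2, h, hc, rfl⟩
  have h2 := hf.biUnion_le_add_sum J (fun j => (part sol j).toFinset) G
  have h3 : ∑ j ∈ J, (f ((part sol j).toFinset ∪ G) - f G) ≤ J.card • f G := by
    refine Finset.sum_le_card_nsmul _ _ _ fun j hj => ?_
    -- The gain over `G` is at most the gain over `shown`, hence at most `f G - f shown ≤ f G`.
    have := hf.union_gain_anti (part sol j).toFinset
      (Finset.subset_union_right : shown ⊆ G)
    linarith [hmax j hj, hf.nonneg shown]
  rw [nsmul_eq_mul] at h3
  linarith

end Exchange

end S3MOR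

namespace S3MOR

/-! ### The effect of the programs -/

section Semantics

/-- Induction over the iterations of a loop. -/
theorem exec_forEach_induct {M Q τ : Type} (f : Q → ℝ) (size : M → ℕ) (l : M → List τ)
    (body : τ → Cmd M Q) (m : M) (P : List τ → Outcome M → Prop) (h0 : P [] ⟨m, 0, size m⟩)
    (hs : ∀ done x o, done ++ [x] <+: l m → P done o →
      P (done ++ [x]) ⟨((body x).exec f size o.mem).mem, o.calls + ((body x).exec f size o.mem).calls,
        max o.peak ((body x).exec f size o.mem).peak⟩) :
    P (l m) ((Cmd.forEach τ l body).exec f size m) := by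
  have key : ∀ rest done o, done ++ rest = l m → P done o →
      P (l m) (rest.foldl (fun o x =>
        ⟨((body x).exec f size o.mem).mem, o.calls + ((body x).exec f size o.mem).calls,
          max o.peak ((body x).exec f size o.mem).peak⟩) o) := by
    intro rest
    induction rest with
    | nil =>
      intro done o h hP
      rw [List.append_nil] at h
      exact h ▸ hP
    | cons x rest ih =>
      intro done o h hP
      rw [List.foldl_cons]
      refine ih (done ++ [x]) _ (by simpa using h) (hs done x o ⟨rest, by simpa using h⟩ hP)
  exact key (l m) [] _ rfl h0

/-- The running optimum `best` after the elements of `L` have been seen: an element of `L` with its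
value, which is related by `le` to all values of elements of `L`. -/
def IsBest {β : Type} (le : ℝ → ℝ → Prop) (g : β → ℝ) (L : List β) (best : Option (β × ℝ)) : Prop :=
  (L = [] ∧ best = none) ∨ ∃ c ∈ L, best = some (c, g c) ∧ ∀ c' ∈ L, le (g c) (g c')

namespace IsBest

variable {β : Type} {le : ℝ → ℝ → Prop} {g : β → ℝ} {L : List β}

theorem of_none (hrefl : ∀ a, le a a) (h : IsBest le g L none) (c : β) :
    IsBest le g (L ++ [c]) (some (c, g c)) := by
  rcases h with ⟨rfl, -⟩ | ⟨c, -, h, -⟩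
  · exact .inr ⟨c, by simp, rfl, by simp [hrefl]⟩
  · cases h

theorem keep {c₀ : β} {v₀ : ℝ} (h : IsBest le g L (some (c₀, v₀))) {c : β} (hc : le v₀ (g c)) :
    IsBest le g (L ++ [c]) (some (c₀, v₀)) := by
  rcases h with ⟨-, h⟩ | ⟨c₁, h1, h, h2⟩
  · cases h
  · cases h
    refine .inr ⟨c₀, by simp [h1], rfl, fun c' hc' => ?_⟩
    rcases List.mem_append.1 hc' with h | h
    · exact h2 c' h
    · rwa [List.mem_singleton.1 h]

theorem replace (hrefl : ∀ a, le a a) (htrans : ∀ {a b c}, le a b → le b c → le a c) {c₀ : β}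
    {v₀ : ℝ} (h : IsBest le g L (some (c₀, v₀))) {c : β} (hc : le (g c) v₀) :
    IsBest le g (L ++ [c]) (some (c, g c)) := by
  rcases h with ⟨-, h⟩ | ⟨c₁, h1, h, h2⟩
  · cases h
  · cases h
    refine .inr ⟨c, by simp, rfl, fun c' hc' => ?_⟩
    rcases List.mem_append.1 hc' with h | h
    · exact htrans hc (h2 c' h)
    · rw [List.mem_singleton.1 h]
      exact hrefl _

end IsBest

/-! ### Register updates and memory size -/

variable {ι : Type} {T' : ℕ}

/-- The two memories differ in the registers only. -/
structure SameStore (m m' : Mem ι T') : Prop where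
  sol : m'.sol = m.sol
  active : m'.active = m.active
  shown : m'.shown = m.shown
  out : m'.out = m.out

theorem SameStore.refl (m : Mem ι T') : SameStore m m := ⟨rfl, rfl, rfl, rfl⟩

theorem SameStore.trans {m m' m'' : Mem ι T'} (h : SameStore m m') (h' : SameStore m' m'') :
    SameStore m m'' :=
  ⟨h'.sol.trans h.sol, h'.active.trans h.active, h'.shown.trans h.shown, h'.out.trans h.out⟩

theorem SameStore.words {m m' : Mem ι T'} (h : SameStore m m') : m'.words = m.words := by
  simp only [Mem.words, h.sol, h.active, h.shown, h.out]

theorem sameStore_setR (v : ℝ) (m : Mem ι T') : SameStore m (setR v m) := ⟨rfl, rfl, rfl, rfl⟩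

theorem sameStore_setS (v : ℝ) (m : Mem ι T') : SameStore m (setS v m) := ⟨rfl, rfl, rfl, rfl⟩

theorem sameStore_updateMin (tie : TieBreak ι T') (c : ι × Fin T') (m : Mem ι T') :
    SameStore m (updateMin tie c m) := by
  unfold updateMin
  split
  · exact ⟨rfl, rfl, rfl, rfl⟩
  · split_ifs
    · exact ⟨rfl, rfl, rfl, rfl⟩
    · exact .refl m

theorem sameStore_updateMax (tie : TieBreak ι T') (j : Fin T') (m : Mem ι T') :
    SameStore m (updateMax tie j m) := by
  unfold updateMax
  split
  · exact ⟨rfl, rfl, rfl, rfl⟩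
  · split_ifs
    · exact ⟨rfl, rfl, rfl, rfl⟩
    · exact .refl m

theorem isBest_updateMin (tie : TieBreak ι T') {c : ι × Fin T'} {m : Mem ι T'}
    {g : ι × Fin T' → ℝ} {L : List (ι × Fin T')} (h : IsBest (· ≤ ·) g L m.best)
    (hc : m.r - m.s = g c) : IsBest (· ≤ ·) g (L ++ [c]) (updateMin tie c m).best := by
  unfold updateMin
  rw [hc]
  split
  · next hb => exact (hb ▸ h).of_none le_refl c
  · next c₀ v₀ hb =>
    rw [hb] at h
    split_ifs with hlt
    · exact h.replace le_refl le_trans (hlt.elim le_of_lt fun h => h.1.le)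
    · rw [hb]
      exact h.keep (not_lt.1 fun h' => hlt (.inl h'))

theorem isBest_updateMax (tie : TieBreak ι T') {j : Fin T'} {m : Mem ι T'}
    {g : Fin T' → ℝ} {L : List (Fin T')} (h : IsBest (· ≥ ·) g L m.bestSet)
    (hj : m.r - m.s = g j) : IsBest (· ≥ ·) g (L ++ [j]) (updateMax tie j m).bestSet := by
  unfold updateMax
  rw [hj]
  split
  · next hb => exact IsBest.of_none (le := (· ≥ ·)) (fun a => le_refl a) (hb ▸ h) j
  · next j₀ v₀ hb =>
    rw [hb] at h
    split_ifs with hlt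
    · exact IsBest.replace (le := (· ≥ ·)) (fun a => le_refl a) (fun h h' => h'.trans h) h (hlt.elim le_of_lt fun h => h.1.ge)
    · rw [hb]
      exact h.keep (not_lt.1 fun h' => hlt (.inl h'))

/-- An upper bound for the words in use while the candidate sets change. -/
def wordBound (k : ℕ) (m : Mem ι T') : ℕ :=
  3 * (T' * k) + m.active.length + 3 * m.shown.flatten.length + m.shown.length
    + 3 * m.out.length + 20

theorem words_le_wordBound {k : ℕ} {m m' : Mem ι T'} (hsol : m'.sol.length ≤ T' * k)
    (ha : m'.active = m.active) (hs : m'.shown = m.shown) (ho : m'.out = m.out) :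
    m'.words ≤ wordBound k m := by
  unfold Mem.words wordBound
  rw [ha, hs, ho]
  omega

/-- The two memories have the same active sets and the same presented sets. -/
structure SameOutput (m m' : Mem ι T') : Prop where
  active : m'.active = m.active
  shown : m'.shown = m.shown
  out : m'.out = m.out

/-! ### Effect and cost of the phases -/

variable [DecidableEq ι]

theorem exec_findMin (f : Finset (ι × Fin T') → ℝ) (tie : TieBreak ι T') (j : Fin T')
    (m : Mem ι T') :
    let o := (findMin tie j).exec f Mem.words m
    SameStore m o.mem ∧ o.calls = 2 * (part m.sol j).length ∧ o.peak ≤ m.words ∧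
      IsBest (· ≤ ·) (incr f m.sol) (part m.sol j) o.mem.best := by
  have hsame : SameStore m { m with best := none } := ⟨rfl, rfl, rfl, rfl⟩
  have hloop := exec_forEach_induct f Mem.words (fun m : Mem ι T' => m.cand j)
    (fun c => Cmd.seq (.call (fun m => insert c (m.before c).toFinset) setR)
      (.seq (.call (fun m => (m.before c).toFinset) setS) (.assign (updateMin tie c))))
    { m with best := none }
    (fun done o => SameStore m o.mem ∧ o.calls = 2 * done.length ∧ o.peak ≤ m.words ∧
      IsBest (· ≤ ·) (incr f m.sol) done o.mem.best)
    ⟨hsame, rfl, hsame.words.le, .inl ⟨rfl, rfl⟩⟩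
    (by
      rintro done c o - ⟨h1, h2, h3, h4⟩
      simp only [Cmd.exec]
      have hR := h1.trans (sameStore_setR (f (insert c (o.mem.before c).toFinset)) o.mem)
      set m₁ := setR (f (insert c (o.mem.before c).toFinset)) o.mem with hm₁
      have hS := hR.trans (sameStore_setS (f (m₁.before c).toFinset) m₁)
      set m₂ := setS (f (m₁.before c).toFinset) m₁ with hm₂
      have hU := hS.trans (sameStore_updateMin tie c m₂)
      refine ⟨hU, ?_, ?_, ?_⟩
      · rw [h2, List.length_append, List.length_singleton]
        ring
      · rw [h1.words, hR.words, hS.words, hU.words]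
        simp [h3]
      · refine isBest_updateMin tie h4 ?_
        have : m.sol = o.mem.sol := h1.sol.symm
        rw [this]
        rfl)
  obtain ⟨h1, h2, h3, h4⟩ := hloop
  refine ⟨h1, ?_, ?_, h4⟩
  · exact (Nat.zero_add _).trans h2
  · exact max_le (max_le le_rfl hsame.words.le) h3

/-- One iteration of the loop over the active candidate sets. -/
theorem exec_offer {f : Finset (ι × Fin T') → ℝ} (hf : MonoSubmodular f) {k : ℕ} (hk : 1 ≤ k)
    (tie : TieBreak ι T') (x : ι) (j : Fin T') (m : Mem ι T') {U : Finset (ι × Fin T')}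
    (hcore : Core f k m.sol U) (hU : (x, j) ∉ U) :
    let o := (Cmd.ite (fun m => decide ((m.cand j).length < k))
      (.assign fun m => { m with sol := m.sol ++ [(x, j)] })
      (.seq (findMin tie j)
        (.seq (.call (fun m => insert (x, j) m.sol.toFinset) setR)
          (.seq (.call (fun m => m.sol.toFinset) setS)
            (.assign (swap (x, j)))))) :
        Cmd (Mem ι T') (Finset (ι × Fin T'))).exec f Mem.words m
    SameOutput m o.mem ∧ (∃ U', Offered f k x [j] m.sol U o.mem.sol U') ∧
      o.calls ≤ 2 * k + 2 ∧ o.peak ≤ wordBound k m := by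
  have hword : m.words ≤ wordBound k m := words_le_wordBound hcore.length_sol_le rfl rfl rfl
  by_cases hlt : (part m.sol j).length < k
  · have hlt' : decide ((m.cand j).length < k) = true := decide_eq_true hlt
    simp only [Cmd.exec, hlt', if_true]
    have hoff := Offered.of_room hf hcore hU hlt
    exact ⟨⟨rfl, rfl, rfl⟩, ⟨_, hoff⟩, Nat.zero_le _,
      max_le hword (words_le_wordBound hoff.core.length_sol_le rfl rfl rfl)⟩
  · have hlt' : decide ((m.cand j).length < k) = false := decide_eq_false hlt
    simp only [Cmd.exec, hlt', Bool.false_eq_true, if_false]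
    obtain ⟨h1, h2, h3, h4⟩ := exec_findMin f tie j m
    set o := (findMin tie j).exec f Mem.words m with ho
    have hR := h1.trans (sameStore_setR (f (insert (x, j) o.mem.sol.toFinset)) o.mem)
    set m₁ := setR (f (insert (x, j) o.mem.sol.toFinset)) o.mem with hm₁
    have hS := hR.trans (sameStore_setS (f m₁.sol.toFinset) m₁)
    set m₂ := setS (f m₁.sol.toFinset) m₁ with hm₂
    have hgain : m₂.r - m₂.s = f (insert (x, j) m.sol.toFinset) - f m.sol.toFinset := by
      rw [← h1.sol]
      rfl
    rw [not_lt] at hlt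
    have hcalls : o.calls + (1 + (1 + 0)) ≤ 2 * k + 2 := by
      have := hcore.length_le j
      omega
    have hpeak : ∀ w, w ≤ wordBound k m →
        max o.peak (max (max o.mem.words m₁.words) (max (max m₁.words m₂.words)
          (max m₂.words w))) ≤ wordBound k m := by
      intro w hw
      rw [h1.words, hR.words, hS.words]
      have := h3.trans hword
      simp [this, hword, hw]
    -- The search cannot come back empty: the candidate set is full and `k ≥ 1`.
    rcases h4 with ⟨hnil, -⟩ | ⟨c', hc', hbest, hmin⟩
    · rw [hnil, List.length_nil] at hlt
      omega
    · have hbest₂ : m₂.best = some (c', incr f m.sol c') := hbest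
      by_cases hsw : 2 * incr f m.sol c' ≤ m₂.r - m₂.s
      · have hswap : swap (x, j) m₂ = { m₂ with sol := m₂.sol.erase c' ++ [(x, j)] } := by
          simp only [swap, hbest₂, if_pos hsw]
        rw [hswap]
        have hoff := Offered.of_swap hf hcore hU hc' hmin (hgain ▸ hsw)
        rw [hS.sol]
        refine ⟨⟨hS.active, hS.shown, hS.out⟩, ⟨_, hoff⟩, hcalls, hpeak _ ?_⟩
        exact words_le_wordBound hoff.core.length_sol_le hS.active hS.shown hS.out
      · have hswap : swap (x, j) m₂ = m₂ := by
          simp only [swap, hbest₂, if_neg hsw]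
        rw [hswap]
        have hoff := Offered.of_reject hf hcore (x := x) hlt hmin (hgain ▸ not_le.1 hsw)
        refine ⟨⟨hS.active, hS.shown, hS.out⟩, ⟨U, ?_⟩, hcalls, hpeak _ (hS.words.trans_le hword)⟩
        rw [hS.sol]
        exact hoff

theorem exec_itemPhase {f : Finset (ι × Fin T') → ℝ} (hf : MonoSubmodular f) {k : ℕ} (hk : 1 ≤ k)
    (tie : TieBreak ι T') (x : ι) (m : Mem ι T') {U : Finset (ι × Fin T')}
    (hcore : Core f k m.sol U) (hU : ∀ c ∈ U, c.1 ≠ x) (hact : m.active.Nodup) :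
    let o := (itemPhase k tie x).exec f Mem.words m
    SameOutput m o.mem ∧ (∃ U', Offered f k x m.active m.sol U o.mem.sol U') ∧
      o.calls ≤ (2 * k + 2) * m.active.length ∧ o.peak ≤ wordBound k m := by
  have hword : m.words ≤ wordBound k m := words_le_wordBound hcore.length_sol_le rfl rfl rfl
  refine exec_forEach_induct f Mem.words (fun m : Mem ι T' => m.active) _ m
    (fun done o => SameOutput m o.mem ∧ (∃ U', Offered f k x done m.sol U o.mem.sol U') ∧
      o.calls ≤ (2 * k + 2) * done.length ∧ o.peak ≤ wordBound k m)
    ⟨⟨rfl, rfl, rfl⟩, ⟨U, .refl x hcore⟩, le_rfl, hword⟩ ?_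
  rintro done j o hpre ⟨h1, ⟨U', h2⟩, h3, h4⟩
  have hj : j ∉ done := fun h =>
    List.disjoint_of_nodup_append (hact.sublist hpre.sublist) h List.mem_cons_self
  -- The copy is new: `U` has no copies of `x`, and this pass has offered `x` only to indices
  -- different from `j`.
  have hjU : (x, j) ∉ U' := fun h =>
    (h2.mem_imp _ h).elim (fun h => hU _ h rfl) fun h => hj h.2
  obtain ⟨h1', ⟨U'', h2'⟩, h3', h4'⟩ := exec_offer hf hk tie x j o.mem h2.core hjU
  refine ⟨⟨h1'.active.trans h1.active, h1'.shown.trans h1.shown, h1'.out.trans h1.out⟩,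
    ⟨U'', h2.trans h2'⟩, ?_, max_le h4 (h4'.trans_eq ?_)⟩
  · rw [List.length_append, List.length_singleton, mul_add, mul_one]
    exact add_le_add h3 h3'
  · simp only [wordBound, h1.active, h1.shown, h1.out]

theorem exec_visitPhase (f : Finset (ι × Fin T') → ℝ) (tie : TieBreak ι T') (m : Mem ι T')
    (hne : m.active ≠ []) :
    let o := (visitPhase tie).exec f Mem.words m
    ∃ j₀ ∈ m.active, o.mem.sol = m.sol ∧ o.mem.active = m.active.erase j₀ ∧
      o.mem.shown = m.shown ++ [part m.sol j₀] ∧ o.mem.out = part m.sol j₀ ∧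
      (∀ j ∈ m.active, f ((part m.sol j).toFinset ∪ m.shown.flatten.toFinset)
          - f m.shown.flatten.toFinset
        ≤ f ((part m.sol j₀).toFinset ∪ m.shown.flatten.toFinset) - f m.shown.flatten.toFinset) ∧
      o.calls = 2 * m.active.length ∧ o.peak ≤ max m.words o.mem.words := by
  have hsame : SameStore m { m with bestSet := none } := ⟨rfl, rfl, rfl, rfl⟩
  obtain ⟨h1, h2, h3, h4⟩ := exec_forEach_induct f Mem.words (fun m : Mem ι T' => m.active)
    (fun j => Cmd.seq (.call (fun m => (m.cand j).toFinset ∪ m.shown.flatten.toFinset) setR)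
      (.seq (.call (fun m => m.shown.flatten.toFinset) setS) (.assign (updateMax tie j))))
    { m with bestSet := none }
    (fun done o => SameStore m o.mem ∧ o.calls = 2 * done.length ∧ o.peak ≤ m.words ∧
      IsBest (· ≥ ·) (fun j => f ((part m.sol j).toFinset ∪ m.shown.flatten.toFinset)
          - f m.shown.flatten.toFinset) done o.mem.bestSet)
    ⟨hsame, rfl, hsame.words.le, .inl ⟨rfl, rfl⟩⟩
    (by
      rintro done j o - ⟨h1, h2, h3, h4⟩
      simp only [Cmd.exec]
      have hR := h1.trans (sameStore_setR
        (f ((o.mem.cand j).toFinset ∪ o.mem.shown.flatten.toFinset)) o.mem)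
      set m₁ := setR (f ((o.mem.cand j).toFinset ∪ o.mem.shown.flatten.toFinset)) o.mem with hm₁
      have hS := hR.trans (sameStore_setS (f m₁.shown.flatten.toFinset) m₁)
      set m₂ := setS (f m₁.shown.flatten.toFinset) m₁ with hm₂
      have hU := hS.trans (sameStore_updateMax tie j m₂)
      refine ⟨hU, ?_, ?_, ?_⟩
      · rw [h2, List.length_append, List.length_singleton]
        ring
      · rw [h1.words, hR.words, hS.words, hU.words]
        simp [h3]
      · refine isBest_updateMax tie h4 ?_
        rw [← h1.sol, ← h1.shown]
        rfl)
  simp only [visitPhase, Cmd.exec] at h1 h2 h3 h4 ⊢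
  set o := List.foldl (fun (o : Outcome (Mem ι T')) (x : Fin T') => _) _ m.active with ho
  rcases h4 with ⟨hnil, -⟩ | ⟨j₀, hj₀, hbest, hmax⟩
  · exact absurd hnil hne
  · have hpres : present o.mem = { o.mem with
        active := o.mem.active.erase j₀, shown := o.mem.shown ++ [o.mem.cand j₀],
        out := o.mem.cand j₀ } := by
      simp only [present, hbest]
    have hcand : o.mem.cand j₀ = part m.sol j₀ := by
      rw [← h1.sol]
      rfl
    refine ⟨j₀, hj₀, ?_, ?_, ?_, ?_, hmax, ?_, ?_⟩
    · rw [hpres]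
      exact h1.sol
    · rw [hpres]
      exact congrArg (fun l : List (Fin T') => l.erase j₀) h1.active
    · rw [hpres, ← hcand, ← h1.shown]
    · rw [hpres, ← hcand]
    · omega
    · rw [hsame.words, h1.words]
      simp [h3]

end Semantics

end S3MOR

namespace S3MOR

/-! ### The run on the stream -/

section Invariant

variable {N T' : ℕ} (f : Finset (Fin N × Fin T') → ℝ) (k : ℕ)

/-- The memory after the items before time `n` were processed. The list `h` records, for every
visit, its time and the index of the candidate set presented; `U` consists of all copies that were
ever stored. -/
structure MemInv (n : ℕ) (m : Mem (Fin N) T') (h : List (Fin N × Fin T'))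
    (U : Finset (Fin N × Fin T')) : Prop where
  core : Core f k m.sol U
  shown : m.shown = h.map fun p => part m.sol p.2
  nodup : (h.map Prod.snd ++ m.active).Nodup
  length : h.length + m.active.length = T'
  lt : ∀ c ∈ U, c.1.val < n
  le_visit : ∀ p ∈ h, ∀ c ∈ part m.sol p.2, c.1 ≤ p.1
  settled_shown : ∀ p ∈ h, ∀ i ≤ p.1, Settled f k m.sol U (i, p.2)
  settled_active : ∀ j ∈ m.active, ∀ i : Fin N, i.val < n → Settled f k m.sol U (i, j)
  -- The bound is stored when a visit happens, because later arrivals change the active sets, which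
  -- the greedy choice has then not compared. It involves only `O` and the presented copies, so it
  -- survives until the next visit.
  ratio : ∀ O : Finset (Fin N × Fin T'), (∀ o ∈ O, ∃ p ∈ h, o.2 = p.2 ∧ o.1 ≤ p.1) →
    (∀ j, (O.filter fun c => c.2 = j).card ≤ k) →
    f O ≤ 4 * ((T' : ℝ) - h.length + 1) * f m.shown.flatten.toFinset
  out_le : m.out.length ≤ k

variable {f} {k}

theorem memInv_init (hf : MonoSubmodular f) : MemInv f k 0 (Mem.init : Mem (Fin N) T') [] ∅ where
  core := ⟨List.nodup_nil, by simp [Mem.init], by simp [Mem.init, part],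
    by simp [Mem.init, hf.map_empty]⟩
  shown := rfl
  nodup := by simpa [Mem.init] using List.nodup_finRange T'
  length := by simp [Mem.init]
  lt := by simp
  le_visit := by simp
  settled_shown := by simp
  settled_active := by simp
  ratio O hO _ := by
    have : O = ∅ := Finset.eq_empty_of_forall_notMem fun o ho => by simpa using hO o ho
    simp [this, Mem.init, hf.map_empty]
  out_le := by simp [Mem.init]

variable {m m' : Mem (Fin N) T'} {h : List (Fin N × Fin T')} {U U' : Finset (Fin N × Fin T')}

/-- Presented indices are not active, so the presented sets stay frozen while all else follows from
`Offered`. -/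
theorem MemInv.offer {x : Fin N} (hm : MemInv f k x m h U) (hs : SameOutput m m')
    (ho : Offered f k x m.active m.sol U m'.sol U') : MemInv f k (x + 1) m' h U' := by
  have hpart : ∀ p ∈ h, part m'.sol p.2 = part m.sol p.2 := fun p hp =>
    ho.part_eq _ fun h' =>
      List.disjoint_of_nodup_append hm.nodup (List.mem_map_of_mem hp) h'
  refine ⟨ho.core, ?_, ?_, ?_, ?_, ?_, ?_, ?_, ?_, ?_⟩
  · rw [hs.shown, hm.shown]
    exact List.map_congr_left fun p hp => (hpart p hp).symm
  · rw [hs.active]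
    exact hm.nodup
  · rw [hs.active]
    exact hm.length
  · intro c hc
    rcases ho.mem_imp c hc with hc | hc
    · exact (hm.lt c hc).trans (Nat.lt_succ_self _)
    · rw [hc.1]
      exact Nat.lt_succ_self _
  · intro p hp
    rw [hpart p hp]
    exact hm.le_visit p hp
  · exact fun p hp i hi => ho.settled _ (hm.settled_shown p hp i hi)
  · intro j hj i hi
    rw [hs.active] at hj
    rcases Nat.lt_succ_iff_lt_or_eq.1 hi with hi | hi
    · exact ho.settled _ (hm.settled_active j hj i hi)
    · rw [Fin.ext hi]
      exact ho.settled_new j hj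
  · rw [hs.shown]
    exact hm.ratio
  · rw [hs.out]
    exact hm.out_le

theorem MemInv.present (hf : MonoSubmodular f) {x : Fin N} (hm : MemInv f k (x + 1) m h U)
    {j₀ : Fin T'} (hj₀ : j₀ ∈ m.active) (hsol : m'.sol = m.sol)
    (hactive : m'.active = m.active.erase j₀) (hshown : m'.shown = m.shown ++ [part m.sol j₀])
    (hout : m'.out = part m.sol j₀)
    (hmax : ∀ j ∈ m.active, f ((part m.sol j).toFinset ∪ m.shown.flatten.toFinset)
          - f m.shown.flatten.toFinset
        ≤ f ((part m.sol j₀).toFinset ∪ m.shown.flatten.toFinset) - f m.shown.flatten.toFinset) :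
    MemInv f k (x + 1) m' (h ++ [(x, j₀)]) U := by
  have hlen : (m.active.erase j₀).length + 1 = m.active.length := by
    rw [List.length_erase_of_mem hj₀]
    have := List.length_pos_of_mem hj₀
    omega
  have hperm : (h.map Prod.snd ++ m.active).Perm
      ((h ++ [(x, j₀)]).map Prod.snd ++ m.active.erase j₀) := by
    rw [List.map_append, List.append_assoc]
    exact (List.perm_cons_erase hj₀).append_left _
  have hnd := hperm.nodup_iff.1 hm.nodup
  have hsettled : ∀ p ∈ h ++ [(x, j₀)], ∀ i ≤ p.1, Settled f k m.sol U (i, p.2) := by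
    intro p hp i hi
    rcases List.mem_append.1 hp with hp | hp
    · exact hm.settled_shown p hp i hi
    · rw [List.mem_singleton.1 hp] at hi ⊢
      -- The item arriving at the visit has already been offered, so `i = x` is included.
      exact hm.settled_active j₀ hj₀ i (Nat.lt_succ_of_le hi)
  refine ⟨hsol ▸ hm.core, ?_, ?_, ?_, hm.lt, ?_, ?_, ?_, ?_, ?_⟩
  · rw [hshown, hsol, hm.shown, List.map_append, List.map_singleton]
  · rw [hactive]
    exact hnd
  · rw [hactive, List.length_append, List.length_singleton]
    have := hm.length
    omega
  · intro p hp c hc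
    rw [hsol] at hc
    rcases List.mem_append.1 hp with hp | hp
    · exact hm.le_visit p hp c hc
    · rw [List.mem_singleton.1 hp]
      refine Nat.le_of_lt_succ (hm.lt c (hm.core.subset ?_))
      exact List.mem_toFinset.2 (mem_part.1 hc).1
  · rw [hsol]
    exact hsettled
  · intro j hj i hi
    rw [hsol]
    rw [hactive] at hj
    exact hm.settled_active j (List.mem_of_mem_erase hj) i hi
  · intro O hO hcard
    have h4 : f O ≤ 4 * f m.sol.toFinset := by
      refine hm.core.le_four_mul hf O (fun o ho => ?_) hcard
      obtain ⟨p, hp, h1, h2⟩ := hO o ho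
      have := hsettled p hp o.1 h2
      rwa [← h1] at this
    have hg : f m.sol.toFinset ≤ (((m.active.erase j₀).toFinset.card : ℕ) + 1)
        * f ((part m.sol j₀).toFinset ∪ m.shown.flatten.toFinset) := by
      refine le_card_succ_mul_of_forall_gain_le hf (fun c hc => ?_) fun j hj =>
        hmax j (List.mem_of_mem_erase (List.mem_toFinset.1 hj))
      have hall : c.2 ∈ (h ++ [(x, j₀)]).map Prod.snd ++ m.active.erase j₀ := by
        -- Presented and active indices are `T'` distinct elements of `Fin T'`, hence all of them,
        -- and no stored copy is overlooked.
        have huniv := Finset.eq_univ_of_card (List.toFinset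
          ((h ++ [(x, j₀)]).map Prod.snd ++ m.active.erase j₀)) (by
            rw [List.toFinset_card_of_nodup hnd, Fintype.card_fin, ← hperm.length_eq,
              List.length_append, List.length_map, hm.length])
        exact List.mem_toFinset.1 (huniv ▸ Finset.mem_univ _)
      simp only [List.map_append, List.mem_append, List.mem_map, List.map_cons, List.map_nil,
        List.mem_singleton] at hall
      rcases hall with (⟨p, hp, hpc⟩ | hc') | hc'
      · left
        rw [hm.shown, List.mem_toFinset, List.mem_flatten]
        exact ⟨_, List.mem_map_of_mem hp, mem_part.2 ⟨hc, hpc.symm⟩⟩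
      · exact .inr (.inl hc')
      · exact .inr (.inr (List.mem_toFinset.2 hc'))
    have hset : m'.shown.flatten.toFinset
        = (part m.sol j₀).toFinset ∪ m.shown.flatten.toFinset := by
      rw [hshown, List.flatten_append, List.toFinset_append, Finset.union_comm]
      simp
    -- The active sets left after this visit number `T'` minus the visits so far, this one included;
    -- the extra 1 pays for the presented union itself.
    have hcount : (((m.active.erase j₀).toFinset.card : ℕ) : ℝ) + 1
        = (T' : ℝ) - (h ++ [(x, j₀)]).length + 1 := by
      rw [List.toFinset_card_of_nodup hnd.of_append_right, List.length_append,
        List.length_singleton]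
      have : (m.active.erase j₀).length + (h.length + 1) = T' := by
        have := hm.length
        omega
      have : ((m.active.erase j₀).length : ℝ) + ((h.length + 1 : ℕ) : ℝ) = T' := by
        exact_mod_cast this
      linarith
    rw [hcount] at hg
    rw [hset, mul_assoc]
    linarith
  · rw [hout]
    exact hm.core.length_le j₀

/-- Active and presented indices together number `T'`, so the terms add up to `3 + 1 + 3 + 3 + 20 =
30` multiples of `T' * k`. -/
theorem MemInv.wordBound_le (hk : 1 ≤ k) (hT' : 1 ≤ T') {n : ℕ} (hm : MemInv f k n m h U) :
    wordBound k m ≤ 30 * (T' * k) := by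
  have hshown : m.shown.length = h.length := by rw [hm.shown, List.length_map]
  have hflat : m.shown.flatten.length ≤ h.length * k := by
    rw [List.length_flatten, ← hshown]
    refine (List.sum_le_card_nsmul _ k fun a ha => ?_).trans_eq (by simp)
    rw [hm.shown] at ha
    simp only [List.map_map, List.mem_map, Function.comp] at ha
    obtain ⟨p, -, rfl⟩ := ha
    exact hm.core.length_le p.2
  have h1 : h.length * k ≤ T' * k := Nat.mul_le_mul_right _ (by have := hm.length; omega)
  have h2 : T' ≤ T' * k := Nat.le_mul_of_pos_right _ hk
  have h3 : k ≤ T' * k := Nat.le_mul_of_pos_left _ hT'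
  have := hm.length
  have := hm.out_le
  unfold wordBound
  omega

/-! ### Accumulated costs over the stream -/

variable (f) (k)

/-- The run before time `n`. -/
structure TraceInv (acc : Fin N → Bool) (n : ℕ) (tr : Trace (Fin N) T')
    (h : List (Fin N × Fin T')) (U : Finset (Fin N × Fin T')) : Prop where
  mem : MemInv f k n tr.mem h U
  visits : h.map Prod.fst = ((List.finRange N).take n).filter acc
  outputs : tr.outputs = tr.mem.shown
  calls_le : tr.calls ≤ 6 * (n * k * T')
  peak_le : tr.peak ≤ 30 * (T' * k)
  responseCalls_length : tr.responseCalls.length = h.length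
  responseCalls_le : ∀ r ∈ tr.responseCalls, r ≤ 2 * T'

variable {f} {k}

theorem take_finRange_succ (x : Fin N) :
    (List.finRange N).take (x + 1) = (List.finRange N).take x ++ [x] := by
  rw [List.take_add_one]
  simp

theorem TraceInv.step (hf : MonoSubmodular f) (hk : 1 ≤ k) (hT' : 1 ≤ T') {acc : Fin N → Bool}
    (hacc : ((List.finRange N).filter acc).length ≤ T') (tie : TieBreak (Fin N) T') {x : Fin N}
    {tr : Trace (Fin N) T'} (ht : TraceInv f k acc x tr h U) :
    ∃ h' U', TraceInv f k acc (x + 1) (step f k tie tr (x, acc x)) h' U' := by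
  have hact := ht.mem.length
  obtain ⟨hsame, ⟨U', hoff⟩, hcalls, hpeak⟩ := exec_itemPhase hf hk tie x tr.mem ht.mem.core
    (fun c hc h => (ht.mem.lt c hc).ne (congrArg Fin.val h)) ht.mem.nodup.of_append_right
  have hm := ht.mem.offer hsame hoff
  have hcalls' : ((itemPhase k tie x).exec f Mem.words tr.mem).calls ≤ 4 * (k * T') := by
    refine hcalls.trans ?_
    calc (2 * k + 2) * tr.mem.active.length ≤ (4 * k) * T' := Nat.mul_le_mul (by omega) (by omega)
      _ = 4 * (k * T') := by ring
  have hTk : T' ≤ k * T' := Nat.le_mul_of_pos_left _ hk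
  -- Per time step, 4 comes from `2k + 2 ≤ 4k` calls per active set and 2 from a possible visit,
  -- using `T' ≤ k * T'`.
  have hbudget : ∀ a b c : ℕ, a ≤ 6 * (x.val * k * T') → b ≤ 4 * (k * T') → c ≤ 2 * T' →
      a + b + c ≤ 6 * ((x.val + 1) * k * T') := by
    intro a b c ha hb hc
    have : (x.val + 1) * k * T' = x.val * k * T' + k * T' := by ring
    omega
  have hpeak' := hpeak.trans (ht.mem.wordBound_le hk hT')
  have hfilter : ((List.finRange N).take (x + 1)).filter acc
      = h.map Prod.fst ++ if acc x then [x] else [] := by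
    rw [take_finRange_succ, List.filter_append, ← ht.visits]
    by_cases hx : acc x <;> simp [hx]
  by_cases hx : acc x
  · rw [if_pos hx] at hfilter
    -- The earlier visits and this one are among all visits, of which there are at most `T'`; so an
    -- active set remains to be presented.
    have hlt : h.length + 1 ≤ T' := by
      refine le_trans ?_ hacc
      have := (((List.take_prefix (x.val + 1) (List.finRange N)).sublist).filter acc).length_le
      rw [hfilter] at this
      simpa using this
    have hne : ((itemPhase k tie x).exec f Mem.words tr.mem).mem.active ≠ [] := by
      rw [hsame.active]
      intro h0
      rw [h0] at hact
      simp only [List.length_nil] at hact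
      omega
    obtain ⟨j₀, hj₀, hsol, hactive, hshown, hout, hmax, hvc, hvp⟩ :=
      exec_visitPhase f tie _ hne
    have hm' := hm.present hf hj₀ hsol hactive hshown hout hmax
    have hvc' : ((visitPhase tie).exec f Mem.words
        ((itemPhase k tie x).exec f Mem.words tr.mem).mem).calls ≤ 2 * T' := by
      rw [hvc, hsame.active]
      omega
    refine ⟨h ++ [(x, j₀)], U', ?_⟩
    simp only [S3MOR.step, hx, if_true]
    refine ⟨hm', ?_, ?_, hbudget _ _ _ ht.calls_le hcalls' hvc', ?_, ?_, ?_⟩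
    · rw [hfilter, List.map_append, List.map_singleton]
    · simp only [hshown, hout, ht.outputs, hsame.shown]
    · have h1 := (words_le_wordBound hm.core.length_sol_le rfl rfl rfl).trans
        (hm.wordBound_le hk hT')
      have h2 := (words_le_wordBound hm'.core.length_sol_le rfl rfl rfl).trans
        (hm'.wordBound_le hk hT')
      exact max_le ht.peak_le (max_le hpeak' (hvp.trans (max_le h1 h2)))
    · simp [ht.responseCalls_length]
    · intro r hr
      rcases List.mem_append.1 hr with hr | hr
      · exact ht.responseCalls_le r hr
      · rw [List.mem_singleton.1 hr]
        exact hvc'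
  · rw [if_neg hx, List.append_nil] at hfilter
    refine ⟨h, U', ?_⟩
    simp only [S3MOR.step, hx]
    exact ⟨hm, hfilter.symm, by simpa [hsame.shown] using ht.outputs,
      hbudget _ _ 0 ht.calls_le hcalls' (Nat.zero_le _), max_le ht.peak_le hpeak',
      ht.responseCalls_length, ht.responseCalls_le⟩

theorem exists_traceInv_storm (hf : MonoSubmodular f) (hk : 1 ≤ k) (hT' : 1 ≤ T')
    {acc : Fin N → Bool} (hacc : ((List.finRange N).filter acc).length ≤ T')
    (tie : TieBreak (Fin N) T') :
    ∃ h U, TraceInv f k acc N (storm f k tie ((List.finRange N).map fun i => (i, acc i))) h U := by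
  have key : ∀ n ≤ N, ∃ h U, TraceInv f k acc n
      (storm f k tie (((List.finRange N).take n).map fun i => (i, acc i))) h U := by
    intro n
    induction n with
    | zero =>
      intro _
      have hinit := memInv_init (N := N) (k := k) hf
      exact ⟨[], ∅, hinit, by simp, rfl, Nat.zero_le _,
        (words_le_wordBound hinit.core.length_sol_le rfl rfl rfl).trans (hinit.wordBound_le hk hT'),
        rfl, by simp [storm]⟩
    | succ n ih =>
      intro hn
      obtain ⟨h, U, ht⟩ := ih (Nat.le_of_succ_le hn)
      have := TraceInv.step (x := ⟨n, hn⟩) hf hk hT' hacc tie ht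
      have htake := take_finRange_succ (⟨n, hn⟩ : Fin N)
      simp only at htake
      rw [htake, List.map_append, storm, List.foldl_append]
      exact this
  have := key N le_rfl
  rwa [List.take_of_length_le (by simp)] at this

end Invariant

/-! ### The competitive ratio -/

section Solution

variable {d N : ℕ} (S : ItemStream d N) {T' : ℕ}

/-- Presentations at distinct visits are copies in distinct candidate sets. -/
theorem value_eq_oracle {σ : Fin (numVisits S) → Fin T'} (hσ : Function.Injective σ)
    (X : Fin (numVisits S) → Finset (Fin N)) :
    value S X = oracle S T' ((Finset.univ.filter fun c : Fin (numVisits S) × Fin N =>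
      c.2 ∈ X c.1).image fun c => (c.2, σ c.1)) := by
  unfold oracle
  rw [expectedCoverage_image]
  · rfl
  · rintro ⟨t, i⟩ ⟨t', i'⟩ h
    obtain ⟨h1, h2⟩ := Prod.mk.inj h
    exact Prod.ext (hσ h2) h1

end Solution

end S3MOR

/-! ### From the final invariant to the guarantees -/

theorem theorem2 :
    ∃ cSpace cTime cResp : ℕ,
      ∀ (d N : ℕ) (S : ItemStream d N) (k T' : ℕ) (_hk : 1 ≤ k) (_hT' : 1 ≤ T')
        (_hT : numVisits S ≤ T') (tie : TieBreak (Fin N) T'),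
        -- one output per visit, and the outputs are a feasible solution
        (stormRun S T' k tie).outputs.length = numVisits S ∧
        Feasible S k (stormSolution S T' k tie) ∧
        -- competitive ratio
        (∀ X : Fin (numVisits S) → Finset (Fin N), Feasible S k X →
          1 / (4 * ((T' : ℝ) - (numVisits S : ℝ) + 1)) * value S X
            ≤ value S (stormSolution S T' k tie)) ∧
        -- space, time (oracle calls over the whole stream), response time (oracle calls per visit)
        (stormRun S T' k tie).peak ≤ cSpace * (T' * k) ∧
        (stormRun S T' k tie).calls ≤ cTime * (N * k * T') ∧
        (stormRun S T' k tie).responseCalls.length = numVisits S ∧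
        ∀ n ∈ (stormRun S T' k tie).responseCalls, n ≤ cResp * T' := by
  refine ⟨30, 6, 2, fun d N S k T' hk hT' hT tie => ?_⟩
  have hf := monoSubmodular_oracle S T'
  obtain ⟨h, U, ht⟩ := exists_traceInv_storm (acc := fun i => (S i).access) hf hk hT' hT tie
  change TraceInv _ _ _ _ (stormRun S T' k tie) _ _ at ht
  set tr := stormRun S T' k tie with htr
  have hvis : h.map Prod.fst = visitTimes S := by
    rw [ht.visits, List.take_of_length_le (by simp)]
    rfl
  have hlen : h.length = numVisits S := by
    rw [numVisits, ← hvis, List.length_map]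
  have hmem : ∀ t : Fin (numVisits S), t.val < h.length := fun t =>
    t.isLt.trans_eq hlen.symm
  have hget : ∀ t : Fin (numVisits S), (visitTimes S).get t = (h[t.val]'(hmem t)).1 := by
    intro t
    have : (visitTimes S).get t = (visitTimes S)[t.val]'t.isLt := rfl
    rw [this]
    simp only [← hvis, List.getElem_map]
  -- The candidate set presented at each visit. It is injective since a presented set is
  -- deactivated, so it relabels visits without merging copies.
  set σ : Fin (numVisits S) → Fin T' := fun t => (h[t.val]'(hmem t)).2 with hσdef
  have hσ : Function.Injective σ := by
    intro t t' htt
    have hnd := ht.mem.nodup.of_append_left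
    have := (List.Nodup.getElem_inj_iff hnd (i := t.val) (j := t'.val)
      (hi := by simpa using hmem t) (hj := by simpa using hmem t')).1 (by simpa using htt)
    exact Fin.ext this
  have hout : ∀ t : Fin (numVisits S), tr.outputs.getD t [] = part tr.mem.sol (σ t) := by
    intro t
    rw [ht.outputs, ht.mem.shown, List.getD_eq_getElem _ _ (by simpa using hmem t)]
    simp [hσdef]
  have hsolmem : ∀ t i, i ∈ stormSolution S T' k tie t ↔ (i, σ t) ∈ part tr.mem.sol (σ t) := by
    intro t i
    rw [stormSolution, ← htr, hout, List.mem_toFinset, List.mem_map]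
    constructor
    · rintro ⟨c, hc, rfl⟩
      have : c = (c.1, σ t) := Prod.ext rfl (mem_part.1 hc).2
      rwa [← this]
    · exact fun hc => ⟨_, hc, rfl⟩
  have houtlen : tr.outputs.length = numVisits S := by
    rw [ht.outputs, ht.mem.shown, List.length_map, hlen]
  refine ⟨houtlen, ?_, ?_, ht.peak_le, ht.calls_le, ht.responseCalls_length.trans hlen,
    ht.responseCalls_le⟩
  · intro t
    constructor
    · rw [stormSolution, ← htr, hout]
      refine (List.toFinset_card_le _).trans ?_
      rw [List.length_map]
      exact ht.mem.core.length_le _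
    · intro i hi
      rw [hget]
      exact ht.mem.le_visit _ (List.getElem_mem (hmem t)) _ ((hsolmem t i).1 hi)
  · intro X hX
    have hshown : (Finset.univ.filter fun c : Fin (numVisits S) × Fin N =>
        c.2 ∈ stormSolution S T' k tie c.1).image (fun c => (c.2, σ c.1))
          = tr.mem.shown.flatten.toFinset := by
      ext c
      simp only [Finset.mem_image, Finset.mem_filter, Finset.mem_univ, true_and,
        List.mem_toFinset, List.mem_flatten, ht.mem.shown, List.mem_map]
      constructor
      · rintro ⟨⟨t, i⟩, hti, rfl⟩
        exact ⟨_, ⟨_, List.getElem_mem (hmem t), rfl⟩, (hsolmem t i).1 hti⟩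
      · rintro ⟨_, ⟨p, hp, rfl⟩, hc⟩
        obtain ⟨t, htl, rfl⟩ := List.getElem_of_mem hp
        have hc2 : c = (c.1, σ ⟨t, hlen ▸ htl⟩) := Prod.ext rfl (mem_part.1 hc).2
        refine ⟨(⟨t, hlen ▸ htl⟩, c.1), (hsolmem _ _).2 ?_, hc2.symm⟩
        rw [← hc2]
        exact hc
    have hratio := ht.mem.ratio ((Finset.univ.filter fun c : Fin (numVisits S) × Fin N =>
        c.2 ∈ X c.1).image fun c => (c.2, σ c.1)) ?_ ?_
    · rw [← value_eq_oracle S hσ, ← hshown, ← value_eq_oracle S hσ, hlen] at hratio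
      have hT'' : (numVisits S : ℝ) ≤ T' := by exact_mod_cast hT
      have hpos : 0 < 4 * ((T' : ℝ) - (numVisits S : ℝ) + 1) := by linarith
      rw [one_div, inv_mul_le_iff₀ hpos]
      exact hratio
    · intro o ho
      obtain ⟨⟨t, i⟩, hti, rfl⟩ := Finset.mem_image.1 ho
      refine ⟨_, List.getElem_mem (hmem t), rfl, ?_⟩
      rw [← hget]
      exact (hX t).2 i (Finset.mem_filter.1 hti).2
    · intro j
      -- By injectivity the copies with label `j` come from a single visit, hence from at most `k`
      -- items, or from none.
      by_cases hj : ∃ t, σ t = j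
      · obtain ⟨t, rfl⟩ := hj
        refine le_trans (Finset.card_le_card (t := (X t).image fun i => (i, σ t)) ?_)
          (Finset.card_image_le.trans (hX t).1)
        intro c hc
        obtain ⟨hc, hct⟩ := Finset.mem_filter.1 hc
        obtain ⟨⟨t', i⟩, hti, rfl⟩ := Finset.mem_image.1 hc
        obtain rfl := hσ hct
        exact Finset.mem_image_of_mem _ (Finset.mem_filter.1 hti).2
      · rw [Finset.filter_false_of_mem, Finset.card_empty]
        · exact Nat.zero_le _
        · intro c hc hcj
          obtain ⟨⟨t', i⟩, hti, rfl⟩ := Finset.mem_image.1 hc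
          exact hj ⟨t', hcj⟩
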